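/- For real $x \ge 1$, an integer $q \ge 1$ and $a \in (\mathbb{Z}/q\mathbb{Z})^\times$, let $$S(x;q,a) = \sum_{\substack{1 \le n \le x \\ n \equiv a \ (\mathrm{mod}\ q)}} |\mu(n)|, \qquad c_q = \prod_{p \nmid q}\left(1 - \frac{1}{p^2}\right), \qquad E(x;q,a) = S(x;q,a) - c_q \frac{x}{q},$$ where $\mu$ is the Möbius function and $p$ runs over primes. Let $\varepsilon > 0$ be fixed. Then there is a constant $C > 0$ depending only on $\varepsilon$ such that, for all real $x \ge 1$ and all integers $q$ with $x^{1/4} \le q \le x^{1/3}$, $$\frac{1}{\varphi(q)}\,\#\left\{ a \in (\mathbb{Z}/q\mathbb{Z})^\times : |E(x;q,a)| > x^{1/4+\varepsilon} q^{1/4} \right\} \le C\, \frac{x^{1/2-\varepsilon}}{q^2},$$ where $\varphi$ is Euler's totient function. Consequently the bound $|E(x;q,a)| \le x^{1/4+\varepsilon} q^{1/4}$ holds for almost all $a$ in this range: for every $\delta > 0$ there is $X \ge 1$, depending only on $\varepsilon$ and $\delta$, such that for all $x \ge X$ and all integers $q$ with $x^{1/4} \le q \le x^{1/3}$, the proportion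 of $a \in (\mathbb{Z}/q\mathbb{Z})^\times$ satisfying this bound is at least $1 - \delta$. -/

import Mathlib

namespace SquarefreeAP

/-- `S(x;q,a) = ∑_{n ≤ x, n ≡ a mod q} |μ(n)|`, the number of squarefree positive integers
`n ≤ x` in the residue class `a` modulo `q`. -/
noncomputable def S (x : ℝ) (q : ℕ) (a : (ZMod q)ˣ) : ℝ :=
  ∑ n ∈ Finset.Icc 1 ⌊x⌋₊ with ((n : ℕ) : ZMod q) = (a : ZMod q),
    ((|ArithmeticFunction.moebius n| : ℤ) : ℝ)

/-- `c_q = ∏_{p ∤ q} (1 - 1 / p²)`, an infinite product over the primes not dividing `q`. -/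
noncomputable def c (q : ℕ) : ℝ :=
  ∏' p : {p : ℕ // p.Prime ∧ ¬ p ∣ q}, (1 - 1 / ((p : ℕ) : ℝ) ^ 2)

/-- The infinite product defining `c_q` converges unconditionally. -/
theorem multipliable_c (q : ℕ) :
    Multipliable fun p : {p : ℕ // p.Prime ∧ ¬ p ∣ q} => (1 - 1 / ((p : ℕ) : ℝ) ^ 2) := by
  have h : Summable fun n : ℕ => 1 / (n : ℝ) ^ 2 :=
    Real.summable_one_div_nat_pow.mpr one_lt_two
  have h' : Summable fun p : {p : ℕ // p.Prime ∧ ¬ p ∣ q} => -(1 / ((p : ℕ) : ℝ) ^ 2) :=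
    (h.comp_injective Subtype.val_injective).neg
  simpa [sub_eq_add_neg] using Real.multipliable_one_add_of_summable h'

/-- The error term `E(x;q,a)`, defined by `S(x;q,a) = c_q x / q + E(x;q,a)`. -/
noncomputable def E (x : ℝ) (q : ℕ) (a : (ZMod q)ˣ) : ℝ :=
  S x q a - c q * (x / q)

end SquarefreeAP

namespace SquarefreeAP

open Finset

/-! Expanding |μ(n)| as the sum of μ(d) over d² ∣ n turns E into a sum over d of μ(d) times the
discrepancy between the number of m ≤ x/d² with md² ≡ a and its expected value. The sum is cut at D
about x^{1/2} q^{-1/4}.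

For d ≤ D (`mainError`) the second moment over all residues is computed by Parseval. Each Fourier
coefficient is O(D τ(q) log 2q) (`norm_fourier_mainError_le`): the sum over m is geometric, and d²k
spreads evenly enough over the multiples of gcd(k, q), since a square class has few roots
(`card_filter_sq_eq_le`). The second moment is thus about D², with no loss of a factor q.

For d > D the bound holds for every unit a (`sum_sqMulCount_tail_le`): m ≤ x/D² is small, and for
fixed m the congruence md² ≡ a again has few solutions d. In the given range of q this tail is
O(τ(q) x^{1/4} q^{1/4}), below half the threshold, so Chebyshev's inequality applied to `mainError`
bounds the exceptional set (`proportion_large_error_le`). Factors τ(q) and log q are absorbed in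
x^ε. -/

/-! ### Möbius expansion over square divisors. -/

theorem sum_moebius_divisors (n : ℕ) :
    ∑ d ∈ n.divisors, ArithmeticFunction.moebius d = if n = 1 then 1 else 0 := by
  rw [← ArithmeticFunction.coe_zeta_mul_apply, ArithmeticFunction.coe_zeta_mul_moebius,
    ArithmeticFunction.one_apply]

theorem sq_dvd_sq_mul_iff {a b d : ℕ} (ha : Squarefree a) (hb : b ≠ 0) :
    d ^ 2 ∣ b ^ 2 * a ↔ d ∣ b := by
  refine ⟨fun h => ?_, fun h => (pow_dvd_pow_of_dvd h 2).mul_right a⟩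
  have hg : 0 < Nat.gcd d b := Nat.gcd_pos_of_pos_right d (Nat.pos_of_ne_zero hb)
  obtain ⟨d', b', hco, hd, hb'⟩ := Nat.exists_coprime d b
  set g := Nat.gcd d b
  have h1 : g ^ 2 * d' ^ 2 ∣ g ^ 2 * (b' ^ 2 * a) := by
    have e1 : d ^ 2 = g ^ 2 * d' ^ 2 := by rw [hd]; ring
    have e2 : b ^ 2 * a = g ^ 2 * (b' ^ 2 * a) := by
      conv_lhs => rw [hb']
      ring
    rwa [e1, e2] at h
  have h2 : d' ^ 2 ∣ b' ^ 2 * a := (Nat.mul_dvd_mul_iff_left (by positivity)).1 h1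
  have h3 : d' ^ 2 ∣ a := (Nat.Coprime.pow 2 2 hco).dvd_of_dvd_mul_left h2
  have h4 : d' = 1 := Nat.isUnit_iff.1 (ha d' (by rwa [← sq]))
  rw [hd, h4, one_mul]
  exact Nat.gcd_dvd_right d b

/-- Write n = b²a with a squarefree: d² ∣ n means d ∣ b, so the sum detects b = 1. -/
theorem sum_moebius_sq_dvd {n N : ℕ} (hn : 1 ≤ n) (hN : n ≤ N) :
    ∑ d ∈ Icc 1 N with d ^ 2 ∣ n, ArithmeticFunction.moebius d
      = |ArithmeticFunction.moebius n| := by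
  obtain ⟨a, b, -, hb, hab, ha⟩ := Nat.sq_mul_squarefree_of_pos hn
  have hs : {d ∈ Icc 1 N | d ^ 2 ∣ n} = b.divisors := by
    ext d
    rw [mem_filter, mem_Icc, Nat.mem_divisors, ← hab, sq_dvd_sq_mul_iff ha hb.ne']
    refine ⟨fun h => ⟨h.2, hb.ne'⟩, fun h => ⟨⟨Nat.pos_of_dvd_of_pos h.1 hb, ?_⟩, h.1⟩⟩
    have h1 : d ≤ b := Nat.le_of_dvd hb h.1
    have h2 : b ^ 2 ≤ n := Nat.le_of_dvd hn ⟨a, hab.symm⟩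
    nlinarith
  rw [hs, sum_moebius_divisors, ArithmeticFunction.abs_moebius]
  refine if_congr ⟨fun h => ?_, fun h => ?_⟩ rfl rfl
  · rwa [← hab, h, one_pow, one_mul]
  · exact Nat.isUnit_iff.1 (h b ⟨a, by rw [← hab, sq]⟩)

/-- The number of `m ≥ 1` with `m d² ≤ x` and `m d² ≡ a mod q`. -/
noncomputable def sqMulCount (x : ℝ) (q d : ℕ) (a : ZMod q) : ℕ :=
  #{m ∈ Icc 1 (⌊x⌋₊ / d ^ 2) | ((m * d ^ 2 : ℕ) : ZMod q) = a}

theorem card_filter_sq_dvd (x : ℝ) (q : ℕ) {d : ℕ} (hd : 1 ≤ d) (a : ZMod q) :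
    #{n ∈ Icc 1 ⌊x⌋₊ | ((n : ℕ) : ZMod q) = a ∧ d ^ 2 ∣ n} = sqMulCount x q d a := by
  have hd2 : 0 < d ^ 2 := by positivity
  symm
  rw [sqMulCount, ← card_image_of_injective (f := fun m => m * d ^ 2) _
    (fun _ _ h => Nat.eq_of_mul_eq_mul_right hd2 h)]
  refine congrArg card (Finset.ext fun n => Iff.symm ?_)
  rw [mem_filter, mem_image, mem_Icc]
  simp only [mem_filter, mem_Icc, Nat.le_div_iff_mul_le hd2]
  constructor
  · rintro ⟨⟨h1, h2⟩, h3, m, rfl⟩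
    rw [mul_comm] at h1 h2 h3
    exact ⟨m, ⟨⟨Nat.pos_of_mul_pos_right (a := m) (b := d^2) h1, h2⟩, h3⟩, mul_comm _ _⟩
  · rintro ⟨m, ⟨⟨h1, h2⟩, h3⟩, rfl⟩
    exact ⟨⟨Nat.mul_pos h1 hd2, h2⟩, h3, dvd_mul_left _ _⟩

theorem S_eq_sum_moebius (x : ℝ) (q : ℕ) (a : (ZMod q)ˣ) {N : ℕ} (hN : ⌊x⌋₊ ≤ N) :
    S x q a = ∑ d ∈ Icc 1 N, (ArithmeticFunction.moebius d : ℝ) * sqMulCount x q d a := by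
  have h1 : S x q a = ∑ n ∈ Icc 1 ⌊x⌋₊ with ((n : ℕ) : ZMod q) = (a : ZMod q),
      ∑ d ∈ Icc 1 N with d ^ 2 ∣ n, (ArithmeticFunction.moebius d : ℝ) := by
    refine sum_congr rfl fun n hn => ?_
    rw [mem_filter, mem_Icc] at hn
    rw [← sum_moebius_sq_dvd hn.1.1 (hn.1.2.trans hN), Int.cast_sum]
  simp only [h1, sum_filter (s := Icc 1 N)]
  rw [sum_comm]
  refine sum_congr rfl fun d hd => ?_
  rw [← card_filter_sq_dvd x q (mem_Icc.1 hd).1, ← sum_filter, filter_filter, sum_const,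
    nsmul_eq_mul, mul_comm]

theorem sqMulCount_eq_zero_of_not_coprime (x : ℝ) {q d : ℕ} (a : (ZMod q)ˣ)
    (h : ¬ d.Coprime q) : sqMulCount x q d a = 0 := by
  rw [sqMulCount, card_eq_zero, filter_eq_empty_iff]
  intro m _ hm
  apply h
  have hu : IsUnit (((m * d ^ 2 : ℕ) : ZMod q)) := hm ▸ a.isUnit
  rw [ZMod.isUnit_iff_coprime] at hu
  exact (Nat.Coprime.coprime_dvd_left (Dvd.intro_left _ rfl) hu).coprime_dvd_left
    (dvd_pow_self d two_ne_zero)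

/-! ### The constant c_q as a Dirichlet series. -/

/-- The summand of the Dirichlet series expansion of `c_q`. -/
noncomputable def cTerm (q n : ℕ) : ℝ :=
  if n.Coprime q then (ArithmeticFunction.moebius n : ℝ) * ((n : ℝ) ^ 2)⁻¹ else 0

theorem abs_cTerm_le (q n : ℕ) : |cTerm q n| ≤ ((n : ℝ) ^ 2)⁻¹ := by
  unfold cTerm
  split_ifs
  · rw [abs_mul, abs_of_nonneg (a := ((n : ℝ) ^ 2)⁻¹) (by positivity)]
    have : |(ArithmeticFunction.moebius n : ℝ)| ≤ 1 := by
      exact_mod_cast ArithmeticFunction.abs_moebius_le_one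
    exact mul_le_of_le_one_left (by positivity) this
  · simp

theorem summable_norm_cTerm (q : ℕ) : Summable fun n => ‖cTerm q n‖ :=
  Summable.of_nonneg_of_le (fun _ => norm_nonneg _) (abs_cTerm_le q)
    (Real.summable_nat_pow_inv.2 one_lt_two)

theorem tsum_cTerm_prime_pow (q : ℕ) {p : ℕ} (hp : p.Prime) :
    ∑' e, cTerm q (p ^ e) = if p ∣ q then 1 else 1 - 1 / (p : ℝ) ^ 2 := by
  rw [tsum_eq_sum (s := range 2)]
  · rw [sum_range_succ, sum_range_one]
    simp only [cTerm, pow_zero, pow_one, hp.coprime_iff_not_dvd,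
      ArithmeticFunction.moebius_apply_prime hp]
    split_ifs <;> simp_all [sub_eq_add_neg]
  · intro e he
    have : 2 ≤ e := by simpa [Nat.lt_iff_add_one_le] using he
    have h0 : ArithmeticFunction.moebius (p ^ e) = 0 := by
      rw [ArithmeticFunction.moebius_apply_prime_pow hp (by omega), if_neg (by omega)]
    simp [cTerm, h0]

theorem c_eq_tsum (q : ℕ) : c q = ∑' n, cTerm q n := by
  have h := EulerProduct.eulerProduct_tprod (f := cTerm q) (by simp [cTerm])
    (by
      intro m n hmn
      simp only [cTerm, Nat.coprime_mul_iff_left]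
      by_cases hm : m.Coprime q
      swap
      · simp [hm]
      by_cases hn : n.Coprime q
      swap
      · simp [hn]
      rw [if_pos ⟨hm, hn⟩, if_pos hm, if_pos hn]
      rw [ArithmeticFunction.isMultiplicative_moebius.map_mul_of_coprime hmn]
      push_cast
      ring) (summable_norm_cTerm q) (by simp [cTerm])
  rw [← h]
  have h1 : ∀ p : Nat.Primes, ∑' e, cTerm q ((p : ℕ) ^ e)
      = if (p : ℕ) ∣ q then 1 else 1 - 1 / ((p : ℕ) : ℝ) ^ 2 := fun p =>
    tsum_cTerm_prime_pow q p.2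
  simp only [h1, c]
  -- Primes dividing q have Euler factor 1, so the product over all primes restricts to those not
  -- dividing q.
  let g : {p : ℕ // p.Prime ∧ ¬ p ∣ q} → Nat.Primes := fun p => ⟨p, p.2.1⟩
  have hg : Function.Injective g := fun p r hpr => Subtype.ext (congrArg (fun t : Nat.Primes => (t : ℕ)) hpr)
  rw [← hg.tprod_eq]
  · refine tprod_congr fun p => ?_
    rw [if_neg p.2.2]
  · intro p hp
    rw [Function.mem_mulSupport] at hp
    exact ⟨⟨p, p.2, fun h => hp (if_pos h)⟩, rfl⟩

theorem abs_c_sub_sum_le (q : ℕ) {D : ℕ} (hD : 1 ≤ D) :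
    |c q - ∑ d ∈ Icc 1 D, cTerm q d| ≤ (D : ℝ)⁻¹ := by
  have hs := (summable_norm_cTerm q).of_norm.hasSum.tendsto_sum_nat
  rw [← c_eq_tsum] at hs
  have h0 : cTerm q 0 = 0 := by simp [cTerm]
  refine le_of_tendsto ((hs.comp (Filter.tendsto_add_atTop_nat 1)).sub_const _).abs ?_
  filter_upwards [Filter.eventually_ge_atTop D] with n hn
  have e : ∑ i ∈ range (n + 1), cTerm q i - ∑ d ∈ Icc 1 D, cTerm q d
      = ∑ d ∈ Ioc D n, cTerm q d := by
    rw [range_eq_Ico, sum_eq_sum_Ico_succ_bot (by omega), h0, zero_add]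
    have : Icc 1 D = Ico 1 (D + 1) := by ext; simp
    have h' : Ioc D n = Ico (D + 1) (n + 1) := by ext; simp
    rw [this, h', ← sum_Ico_consecutive _ (show 1 ≤ D + 1 by omega) (show D + 1 ≤ n + 1 by omega)]
    exact add_sub_cancel_left _ _
  simp only [Function.comp]
  rw [e]
  calc |∑ d ∈ Ioc D n, cTerm q d| ≤ ∑ d ∈ Ioc D n, ((d : ℝ) ^ 2)⁻¹ :=
        (abs_sum_le_sum_abs _ _).trans (sum_le_sum fun d _ => abs_cTerm_le q d)
    _ ≤ (D : ℝ)⁻¹ - (n : ℝ)⁻¹ := sum_Ioc_inv_sq_le_sub (by omega) hn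
    _ ≤ (D : ℝ)⁻¹ := by linarith [show 0 ≤ (n : ℝ)⁻¹ by positivity]

/-! ### Bounds for the totient and the divisor function. -/

theorem le_totient_mul_card_divisors (q : ℕ) : q ≤ q.totient * #q.divisors := by
  induction q using Nat.recOnPosPrimePosCoprime with
  | prime_pow p n hp hn =>
    obtain ⟨k, rfl⟩ : ∃ k, n = k + 1 := ⟨n - 1, by omega⟩
    rw [Nat.totient_prime_pow_succ hp, Nat.divisors_prime_pow hp, card_map, card_range, pow_succ,
      mul_assoc]
    refine Nat.mul_le_mul_left _ ?_
    have h2 := hp.two_le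
    calc p ≤ (p - 1) * 2 := by omega
      _ ≤ (p - 1) * (k + 1 + 1) := Nat.mul_le_mul_left _ (by omega)
  | zero => simp
  | one => simp
  | coprime a b _ _ hab iha ihb =>
    rw [Nat.totient_mul hab, hab.card_divisors_mul]
    calc a * b ≤ (a.totient * #a.divisors) * (b.totient * #b.divisors) := Nat.mul_le_mul iha ihb
      _ = _ := by ring

/-- Compare τ(n) with n^η prime by prime. If p ≥ B then p^η ≥ 2 and e + 1 ≤ 2^e costs nothing; each
of the at most B smaller primes costs a factor K, by Bernoulli's inequality. -/
theorem exists_card_divisors_le {η : ℝ} (hη : 0 < η) :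
    ∃ C : ℝ, 1 ≤ C ∧ ∀ n : ℕ, 1 ≤ n → (#n.divisors : ℝ) ≤ C * (n : ℝ) ^ η := by
  obtain ⟨B, hB⟩ := exists_nat_ge ((2 : ℝ) ^ η⁻¹)
  set t : ℝ := 2 ^ η - 1
  have ht : 0 < t := sub_pos.2 (Real.one_lt_rpow one_lt_two hη)
  set K : ℝ := max 1 t⁻¹
  have hK1 : 1 ≤ K := le_max_left _ _
  have hKt : 1 ≤ K * t := by
    calc 1 = t⁻¹ * t := (inv_mul_cancel₀ ht.ne').symm
      _ ≤ K * t := by gcongr; exact le_max_right _ _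
  have key : ∀ p e : ℕ, p.Prime →
      ((e + 1 : ℕ) : ℝ) ≤ (if p < B then K else 1) * ((p : ℝ) ^ η) ^ e := by
    intro p e hp
    have hp2 : (2 : ℝ) ≤ p := by exact_mod_cast hp.two_le
    split_ifs with hpB
    · have h1 : 1 + (e : ℝ) * t ≤ ((p : ℝ) ^ η) ^ e := by
        calc 1 + (e : ℝ) * t ≤ (1 + t) ^ e := one_add_mul_le_pow (by linarith) e
          _ ≤ _ := by
            refine pow_le_pow_left₀ (by linarith) ?_ e
            rw [show 1 + t = 2 ^ η by simp [t]]
            exact Real.rpow_le_rpow zero_le_two hp2 hη.le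
      calc ((e + 1 : ℕ) : ℝ) ≤ K * (1 + e * t) := by
            push_cast
            nlinarith [(Nat.cast_nonneg e : (0 : ℝ) ≤ e)]
        _ ≤ _ := by gcongr
    · have h2 : (2 : ℝ) ≤ (p : ℝ) ^ η := by
        calc (2 : ℝ) = ((2 : ℝ) ^ η⁻¹) ^ η := by
              rw [← Real.rpow_mul zero_le_two, inv_mul_cancel₀ hη.ne', Real.rpow_one]
          _ ≤ (p : ℝ) ^ η := by
              refine Real.rpow_le_rpow (by positivity) (hB.trans ?_) hη.le
              exact_mod_cast not_lt.1 hpB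
      rw [one_mul]
      calc ((e + 1 : ℕ) : ℝ) ≤ (2 : ℝ) ^ e := by exact_mod_cast Nat.lt_two_pow_self
        _ ≤ _ := by gcongr
  refine ⟨K ^ B, one_le_pow₀ hK1, fun n hn => ?_⟩
  have hn0 : n ≠ 0 := by omega
  have hnη : (n : ℝ) ^ η = ∏ p ∈ n.primeFactors, ((p : ℝ) ^ η) ^ n.factorization p := by
    conv_lhs => rw [← Nat.prod_factorization_pow_eq_self hn0]
    rw [Finsupp.prod, Nat.support_factorization, Nat.cast_prod,
      ← Real.finsetProd_rpow _ _ fun _ _ => by positivity]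
    refine prod_congr rfl fun p _ => ?_
    rw [Nat.cast_pow, ← Real.rpow_natCast, ← Real.rpow_natCast, ← Real.rpow_mul (by positivity),
      ← Real.rpow_mul (by positivity), mul_comm]
  rw [Nat.card_divisors hn0, Nat.cast_prod, hnη]
  calc ∏ p ∈ n.primeFactors, ((n.factorization p + 1 : ℕ) : ℝ)
      ≤ ∏ p ∈ n.primeFactors, (if p < B then K else 1) * ((p : ℝ) ^ η) ^ n.factorization p :=
        prod_le_prod (fun _ _ => by positivity)
          fun p hp => key p _ (Nat.prime_of_mem_primeFactors hp)
    _ = (∏ p ∈ n.primeFactors, if p < B then K else 1)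
          * ∏ p ∈ n.primeFactors, ((p : ℝ) ^ η) ^ n.factorization p := prod_mul_distrib
    _ ≤ _ := by
        refine mul_le_mul_of_nonneg_right ?_ (prod_nonneg fun _ _ => by positivity)
        rw [prod_ite, prod_const, prod_const_one, mul_one]
        refine pow_le_pow_right₀ hK1 ?_
        calc #{p ∈ n.primeFactors | p < B} ≤ #(range B) :=
              card_le_card fun p hp => mem_range.2 (mem_filter.1 hp).2
          _ = B := card_range B

/-! ### Counting square roots modulo n. -/

theorem card_le_of_pairwise_dvd_sub {h Y : ℕ} {s : Finset ℕ} (hs : s ⊆ range Y)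
    (hd : ∀ u ∈ s, ∀ v ∈ s, (h : ℤ) ∣ (u : ℤ) - v) : #s ≤ Y / h + 1 := by
  rw [← card_range (Y / h + 1)]
  refine card_le_card_of_injOn (fun u => u / h) (fun u hu => ?_) fun u hu v hv huv => ?_
  · have := mem_range.1 (hs hu)
    simp only [coe_range, Set.mem_Iio, Nat.lt_succ_iff]
    exact Nat.div_le_div_right this.le
  · have h1 : u % h = v % h := ((Nat.modEq_iff_dvd).2 (hd v hv u hu)).symm ▸ rfl
    have h2 : u / h = v / h := huv
    rw [← Nat.div_add_mod u h, ← Nat.div_add_mod v h, h1, h2]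

/-- A root z of z² ≡ w² has n = ef with e = gcd(z − w, n) and f ∣ z + w. Two roots with the same e
differ by a multiple of both e and f, and gcd(e, f) divides 2w and n, hence 2. So ef divides twice
the difference. -/
theorem dvd_two_mul_sub_of_gcd_eq {n : ℕ} (hn : 1 ≤ n) {w u v : ℤ} (hw : IsCoprime w (n : ℤ))
    (hu : (n : ℤ) ∣ u ^ 2 - w ^ 2) (hv : (n : ℤ) ∣ v ^ 2 - w ^ 2)
    (huv : Int.gcd (u - w) n = Int.gcd (v - w) n) : (n : ℤ) ∣ 2 * (u - v) := by
  have hn0 : (n : ℤ) ≠ 0 := by exact_mod_cast (by omega : n ≠ 0)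
  have cofactor : ∀ z : ℤ, (n : ℤ) ∣ z ^ 2 - w ^ 2 → ∀ e f : ℤ, (Int.gcd (z - w) n : ℤ) = e →
      e * f = n → f ∣ z + w := by
    rintro z hz e f rfl hef
    have he : ((Int.gcd (z - w) n : ℕ) : ℤ) ≠ 0 := left_ne_zero_of_mul (hef ▸ hn0)
    obtain ⟨r, hr⟩ := Int.gcd_dvd_left (a := z - w) (b := (n : ℤ))
    have hco : IsCoprime f r := by
      have hb := Int.gcd_eq_gcd_ab (z - w) n
      refine ⟨Int.gcdB (z - w) n, Int.gcdA (z - w) n, ?_⟩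
      apply mul_left_cancel₀ he
      generalize Int.gcdA (z - w) n = α at *
      generalize Int.gcdB (z - w) n = β at *
      generalize ((Int.gcd (z - w) n : ℕ) : ℤ) = e at *
      linear_combination β * hef - α * hr - hb
    have h1 : f ∣ r * (z + w) := by
      rw [← mul_dvd_mul_iff_left he, hef, ← mul_assoc, ← hr]
      rwa [show (z - w) * (z + w) = z ^ 2 - w ^ 2 by ring]
    exact hco.dvd_of_dvd_mul_left h1
  obtain ⟨f, hf⟩ := Int.gcd_dvd_right (a := u - w) (b := (n : ℤ))
  set e : ℤ := ((Int.gcd (u - w) n : ℕ) : ℤ)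
  have hfu : f ∣ u + w := cofactor u hu e f rfl hf.symm
  have hfv : f ∣ v + w := cofactor v hv e f (by rw [← huv]) hf.symm
  have heu : e ∣ u - w := Int.gcd_dvd_left _ _
  have hev : e ∣ v - w := by
    have h := Int.gcd_dvd_left (a := v - w) (b := (n : ℤ))
    rwa [← huv] at h
  have het : e ∣ u - v := by simpa using dvd_sub heu hev
  have hft : f ∣ u - v := by simpa using dvd_sub hfu hfv
  have hg2 : (Int.gcd e f : ℤ) ∣ 2 := by
    have h1 : (Int.gcd e f : ℤ) ∣ 2 * w := by
      have h := dvd_sub ((Int.gcd_dvd_right (a := e) (b := f)).trans hfu)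
        ((Int.gcd_dvd_left (a := e) (b := f)).trans heu)
      rwa [show u + w - (u - w) = 2 * w by ring] at h
    have h2 : (Int.gcd e f : ℤ) ∣ n := hf ▸ (Int.gcd_dvd_left (a := e) (b := f)).mul_right f
    exact (hw.symm.of_isCoprime_of_dvd_left h2).dvd_of_dvd_mul_right h1
  have hgt : (n : ℤ) ∣ Int.gcd e f * (u - v) := by
    rw [Int.gcd_eq_gcd_ab, add_mul]
    obtain ⟨r, hr⟩ := het
    obtain ⟨t, ht⟩ := hft
    refine dvd_add ⟨Int.gcdA e f * t, ?_⟩ ⟨Int.gcdB e f * r, ?_⟩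
    · rw [hf, ht]; ring
    · rw [hf, hr]; ring
  exact hgt.trans (mul_dvd_mul_right hg2 _)

theorem exists_half_modulus {n : ℕ} (hn : 1 ≤ n) :
    ∃ h : ℕ, 1 ≤ h ∧ n ≤ 2 * h ∧ ∀ t : ℤ, (n : ℤ) ∣ 2 * t → (h : ℤ) ∣ t := by
  rcases Nat.even_or_odd' n with ⟨k, rfl | rfl⟩
  · refine ⟨k, by omega, le_rfl, fun t ht => ?_⟩
    push_cast at ht
    exact (mul_dvd_mul_iff_left two_ne_zero).1 ht
  · refine ⟨2 * k + 1, hn, by omega, fun t ht => ?_⟩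
    refine IsCoprime.dvd_of_dvd_mul_left ?_ ht
    exact ⟨1, -k, by push_cast; ring⟩

/-- Roots are sorted by gcd(u − w, n) for a fixed root w. Within each of the at most τ(n) classes
they are congruent modulo some h ≥ n/2. -/
theorem card_filter_sq_eq_le {n : ℕ} (hn : 1 ≤ n) (b : (ZMod n)ˣ) (Y : ℕ) :
    n * #{u ∈ range Y | ((u : ℕ) : ZMod n) ^ 2 = (b : ZMod n)} ≤ #n.divisors * (2 * Y + n) := by
  set s := {u ∈ range Y | ((u : ℕ) : ZMod n) ^ 2 = (b : ZMod n)} with hs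
  rcases s.eq_empty_or_nonempty with h0 | ⟨w, hw⟩
  · simp [h0]
  obtain ⟨h, hh, hnh, hdvd⟩ := exists_half_modulus hn
  have hsq : ∀ u ∈ s, (n : ℤ) ∣ (u : ℤ) ^ 2 - (w : ℤ) ^ 2 := by
    intro u hu
    rw [← ZMod.intCast_zmod_eq_zero_iff_dvd]
    push_cast
    rw [(mem_filter.1 hu).2, (mem_filter.1 hw).2, sub_self]
  have hco : IsCoprime (w : ℤ) (n : ℤ) := by
    rw [Nat.isCoprime_iff_coprime, ← ZMod.isUnit_iff_coprime]
    have : IsUnit ((w : ZMod n) ^ 2) := (mem_filter.1 hw).2 ▸ b.isUnit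
    exact (isUnit_pow_iff two_ne_zero).1 this
  have hmaps : ∀ u ∈ s, Int.gcd ((u : ℤ) - w) n ∈ n.divisors := fun u _ =>
    Nat.mem_divisors.2 ⟨by exact_mod_cast Int.gcd_dvd_right (a := (u : ℤ) - w) (b := n), by omega⟩
  have hcard : #s ≤ #n.divisors * (Y / h + 1) := by
    rw [card_eq_sum_card_fiberwise hmaps, ← smul_eq_mul, ← sum_const]
    refine sum_le_sum fun e _ => ?_
    refine card_le_of_pairwise_dvd_sub ((filter_subset _ _).trans (filter_subset _ _)) ?_
    intro u hu v hv
    rw [mem_filter] at hu hv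
    exact hdvd _ (dvd_two_mul_sub_of_gcd_eq hn hco (hsq u hu.1) (hsq v hv.1)
      (hu.2.trans hv.2.symm))
  calc n * #s ≤ n * (#n.divisors * (Y / h + 1)) := Nat.mul_le_mul_left _ hcard
    _ = #n.divisors * (n * (Y / h) + n) := by ring
    _ ≤ #n.divisors * (2 * h * (Y / h) + n) := by gcongr
    _ = #n.divisors * (2 * (h * (Y / h)) + n) := by ring
    _ ≤ #n.divisors * (2 * Y + n) := by gcongr; exact Nat.mul_div_le Y h

/-! ### Parseval and exponential sums modulo q. -/

theorem sum_norm_sq_fourier {q : ℕ} [NeZero q] (f : ZMod q → ℝ) :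
    ∑ k : ZMod q, ‖∑ a : ZMod q, (f a : ℂ) * ZMod.stdAddChar (a * k)‖ ^ 2
      = q * ∑ a : ZMod q, f a ^ 2 := by
  have hconj : ∀ z : ZMod q, (starRingEnd ℂ) (ZMod.stdAddChar z) = ZMod.stdAddChar (-z) :=
    fun z => (AddChar.map_neg_eq_conj _ _).symm
  have h : ∀ k : ZMod q, ((‖∑ a : ZMod q, (f a : ℂ) * ZMod.stdAddChar (a * k)‖ ^ 2 : ℝ) : ℂ)
      = ∑ a : ZMod q, ∑ b : ZMod q, (f a * f b : ℂ) * ZMod.stdAddChar (k * (a - b)) := by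
    intro k
    rw [Complex.ofReal_pow, ← Complex.mul_conj', map_sum, sum_mul_sum]
    refine sum_congr rfl fun a _ => sum_congr rfl fun b _ => ?_
    rw [map_mul (starRingEnd ℂ), Complex.conj_ofReal, hconj, show k * (a - b) = a * k + -(b * k) by ring,
      AddChar.map_add_eq_mul]
    ring
  apply Complex.ofReal_injective
  rw [Complex.ofReal_sum, sum_congr rfl fun k _ => h k, sum_comm]
  push_cast
  rw [mul_sum]
  refine sum_congr rfl fun a _ => ?_
  rw [sum_comm]
  simp only [← mul_sum]
  rw [sum_eq_single a]
  · simp [ZMod.card, mul_comm, sq]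
  · intro b _ hb
    rw [AddChar.sum_mulShift _ (ZMod.isPrimitive_stdAddChar q), if_neg (sub_ne_zero.2 hb.symm)]
    simp
  · simp

/-- This is |e(θ) − 1| = 2|sin πθ| with Jordan's inequality sin t ≥ 2t/π on [0, π/2]; `valMinAbs`
keeps |θ| ≤ 1/2. -/
theorem norm_stdAddChar_sub_one_ge {q : ℕ} [NeZero q] (j : ZMod q) :
    4 * (j.valMinAbs.natAbs : ℝ) / q ≤ ‖ZMod.stdAddChar j - 1‖ := by
  have hq : (0 : ℝ) < q := by exact_mod_cast NeZero.pos q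
  have e : ZMod.stdAddChar j
      = Complex.exp (Complex.I * ((2 * Real.pi * j.valMinAbs / q : ℝ) : ℂ)) := by
    conv_lhs => rw [← ZMod.coe_valMinAbs j]
    rw [ZMod.stdAddChar_coe]
    congr 1
    push_cast
    ring
  have hj : (j.valMinAbs.natAbs : ℝ) ≤ q / 2 := by
    calc (j.valMinAbs.natAbs : ℝ) ≤ (q / 2 : ℕ) := by exact_mod_cast ZMod.natAbs_valMinAbs_le j
      _ ≤ q / 2 := Nat.cast_div_le
  have habs : (j.valMinAbs.natAbs : ℝ) = |(j.valMinAbs : ℝ)| := by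
    rw [Nat.cast_natAbs, Int.cast_abs]
  set z : ℝ := (j.valMinAbs : ℝ)
  rw [e, Complex.norm_exp_I_mul_ofReal_sub_one, Real.norm_eq_abs, abs_mul, abs_two, habs]
  rw [habs] at hj
  have h1 : |Real.sin (2 * Real.pi * z / q / 2)| = Real.sin (Real.pi * |z| / q) := by
    have h2 : 0 ≤ Real.pi * |z| / q := by positivity
    have h3 : Real.pi * |z| / q ≤ Real.pi := by
      rw [div_le_iff₀ hq]
      gcongr
      linarith
    rw [← abs_of_nonneg (Real.sin_nonneg_of_nonneg_of_le_pi h2 h3)]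
    rcases abs_choice z with h | h <;> rw [h]
    · congr 2; ring
    · rw [← abs_neg, ← Real.sin_neg]
      congr 2; ring
  have h4 := Real.mul_le_sin (x := Real.pi * |z| / q) (by positivity) (by
    rw [div_le_iff₀ hq]
    nlinarith [Real.pi_pos])
  rw [h1]
  calc 4 * |z| / q = 2 * (2 / Real.pi * (Real.pi * |z| / q)) := by
        field_simp
        ring
    _ ≤ _ := by gcongr

theorem norm_sum_stdAddChar_le {q : ℕ} [NeZero q] {j : ZMod q} (hj : j ≠ 0) (M : ℕ) :
    ‖∑ m ∈ Icc 1 M, ZMod.stdAddChar ((m : ZMod q) * j)‖ ≤ q / (2 * j.valMinAbs.natAbs) := by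
  have hq : (0 : ℝ) < q := by exact_mod_cast NeZero.pos q
  have hj0 : 0 < (j.valMinAbs.natAbs : ℝ) := by
    exact_mod_cast Int.natAbs_pos.2 (mt (ZMod.valMinAbs_eq_zero j).1 hj)
  have hge := norm_stdAddChar_sub_one_ge j
  have hpos : 0 < ‖ZMod.stdAddChar j - 1‖ := lt_of_lt_of_le (by positivity) hge
  have hne : ZMod.stdAddChar j ≠ 1 := fun h => by simp [h] at hpos
  have e : ∑ m ∈ Icc 1 M, ZMod.stdAddChar ((m : ZMod q) * j)
      = ZMod.stdAddChar j * ((ZMod.stdAddChar j ^ M - 1) / (ZMod.stdAddChar j - 1)) := by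
    rw [← geom_sum_eq hne, mul_sum, ← Ico_succ_right_eq_Icc, sum_Ico_eq_sum_range]
    refine sum_congr (by simp) fun i _ => ?_
    rw [← nsmul_eq_mul, AddChar.map_nsmul_eq_pow, add_comm, pow_succ, mul_comm]
  rw [e, norm_mul, AddChar.norm_apply, one_mul, norm_div, div_le_iff₀ hpos]
  calc ‖ZMod.stdAddChar j ^ M - 1‖ ≤ ‖ZMod.stdAddChar j ^ M‖ + ‖(1 : ℂ)‖ := norm_sub_le _ _
    _ = 2 := by rw [norm_pow, AddChar.norm_apply]; norm_num
    _ = q / (2 * j.valMinAbs.natAbs) * (4 * (j.valMinAbs.natAbs : ℝ) / q) := by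
        field_simp
        norm_num
    _ ≤ _ := by gcongr

/-- Only j = ±gi have least absolute residue gi, and together they contribute at most q/(gi) = n/i.
-/
theorem sum_inv_natAbs_valMinAbs_le {q g n : ℕ} [NeZero q] (hg : g * n = q) :
    ∑ j : ZMod q with j ≠ 0 ∧ g ∣ j.valMinAbs.natAbs, (q : ℝ) / (2 * j.valMinAbs.natAbs)
      ≤ n * (harmonic n : ℝ) := by
  have hq : 0 < q := NeZero.pos q
  have hg0 : 0 < g := Nat.pos_of_ne_zero fun h => by simp [h] at hg; omega
  have hn0 : 0 < n := Nat.pos_of_ne_zero fun h => by simp [h] at hg; omega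
  have hmaps : ∀ j ∈ ({j : ZMod q | j ≠ 0 ∧ g ∣ j.valMinAbs.natAbs} : Finset (ZMod q)),
      j.valMinAbs.natAbs / g ∈ Icc 1 n := by
    intro j hj
    rw [mem_filter] at hj
    have hpos : 0 < j.valMinAbs.natAbs := Int.natAbs_pos.2 (mt (ZMod.valMinAbs_eq_zero j).1 hj.2.1)
    rw [mem_Icc]
    refine ⟨Nat.div_pos (Nat.le_of_dvd hpos hj.2.2) hg0, ?_⟩
    refine Nat.div_le_of_le_mul ?_
    rw [hg]
    exact (ZMod.natAbs_valMinAbs_le j).trans (Nat.div_le_self _ _)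
  rw [← sum_fiberwise_of_maps_to hmaps, harmonic_eq_sum_Icc, Rat.cast_sum, mul_sum]
  refine sum_le_sum fun i hi => ?_
  have hi1 : 1 ≤ i := (mem_Icc.1 hi).1
  have hcard : #{j ∈ ({j : ZMod q | j ≠ 0 ∧ g ∣ j.valMinAbs.natAbs} : Finset (ZMod q)) |
      j.valMinAbs.natAbs / g = i} ≤ 2 := by
    refine (card_le_card (t := {((g * i : ℕ) : ZMod q), -((g * i : ℕ) : ZMod q)}) ?_).trans
      card_le_two
    intro j hj
    simp only [mem_filter, mem_univ, true_and] at hj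
    have h1 : j.valMinAbs.natAbs = g * i := by rw [← hj.2, Nat.mul_div_cancel' hj.1.2]
    rw [mem_insert, mem_singleton]
    rcases Int.natAbs_eq j.valMinAbs with h | h
    · left
      rw [← ZMod.coe_valMinAbs j, h, h1]
      simp
    · right
      rw [← ZMod.coe_valMinAbs j, h, h1]
      simp
  calc _ ≤ ∑ j ∈ ({j : ZMod q | j ≠ 0 ∧ g ∣ j.valMinAbs.natAbs} : Finset (ZMod q)) with
          j.valMinAbs.natAbs / g = i, (q : ℝ) / (2 * (g * i : ℕ)) := by
        refine sum_le_sum fun j hj => ?_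
        simp only [mem_filter, mem_univ, true_and] at hj
        rw [← hj.2, Nat.mul_div_cancel' hj.1.2]
    _ ≤ 2 * ((q : ℝ) / (2 * (g * i : ℕ))) := by
        rw [sum_const, nsmul_eq_mul]
        gcongr
        exact_mod_cast hcard
    _ = n * (((i : ℚ)⁻¹ : ℚ) : ℝ) := by
        rw [← hg]
        push_cast
        field_simp

/-- With g = gcd(k, q) and n = q/g, the values d²k are nonzero multiples of g, each taken by at most
5Dτ(q)/n values of d. The factor n lost in the harmonic sum over multiples of g cancels this n. -/
theorem sum_coprime_sq_mul_le {q D : ℕ} [NeZero q] (hD : q ≤ D) {k : ZMod q} (hk : k ≠ 0) :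
    ∑ d ∈ Icc 1 D with d.Coprime q,
        (q : ℝ) / (2 * ((d : ZMod q) ^ 2 * k).valMinAbs.natAbs)
      ≤ 5 * D * #q.divisors * (harmonic q : ℝ) := by
  have hq : 0 < q := NeZero.pos q
  have hg : 0 < Nat.gcd k.val q := Nat.gcd_pos_of_pos_right _ hq
  obtain ⟨k', n, hco, hk', hn⟩ := Nat.exists_coprime k.val q
  have hgk := Nat.gcd_dvd_left k.val q
  have hgq := Nat.gcd_dvd_right k.val q
  have hgn : Nat.gcd k.val q * n = q := by rw [mul_comm]; exact hn.symm
  clear hn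
  generalize Nat.gcd k.val q = g at *
  have hn0 : 1 ≤ n := Nat.pos_of_ne_zero fun h => by simp [h] at hgn; omega
  have hnq : n ∣ q := Dvd.intro_left g hgn
  have hkv : (k.val : ZMod q) = k := ZMod.natCast_zmod_val k
  set s := {d ∈ Icc 1 D | d.Coprime q}
  have hmaps : ∀ d ∈ s, (d : ZMod q) ^ 2 * k ∈
      ({j : ZMod q | j ≠ 0 ∧ g ∣ j.valMinAbs.natAbs} : Finset (ZMod q)) := by
    intro d hd
    have hu : IsUnit ((d : ZMod q) ^ 2) :=
      ((ZMod.isUnit_iff_coprime d q).2 (mem_filter.1 hd).2).pow 2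
    rw [mem_filter]
    refine ⟨mem_univ _, fun h => hk (hu.mul_right_eq_zero.1 h), ?_⟩
    have h1 : (q : ℤ) ∣ ((d : ZMod q) ^ 2 * k).valMinAbs - (d : ℤ) ^ 2 * k.val := by
      rw [← ZMod.intCast_zmod_eq_zero_iff_dvd]
      push_cast
      rw [hkv, sub_self]
    have h2 : (g : ℤ) ∣ (d : ℤ) ^ 2 * k.val :=
      (Int.natCast_dvd_natCast.2 hgk).mul_left _
    have h3 := (dvd_sub_left h2).1 ((Int.natCast_dvd_natCast.2 hgq).trans h1)
    exact Int.natCast_dvd.1 h3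
  have hfib : ∀ j : ZMod q, ((#{d ∈ s | ((d : ℕ) : ZMod q) ^ 2 * k = j} : ℕ) : ℝ)
      ≤ 5 * D * #q.divisors / n := by
    intro j
    rw [le_div_iff₀ (by exact_mod_cast hn0)]
    rcases ({d ∈ s | ((d : ℕ) : ZMod q) ^ 2 * k = j}).eq_empty_or_nonempty with h0 | ⟨w, hw⟩
    · rw [h0, card_empty, Nat.cast_zero, zero_mul]
      positivity
    have hwco : w.Coprime n :=
      Nat.Coprime.coprime_dvd_right hnq (mem_filter.1 (mem_filter.1 hw).1).2
    -- As k = gk' with k' coprime to n, d²k ≡ w²k mod q reduces to d² ≡ w² mod n.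
    have hsub : {d ∈ s | ((d : ℕ) : ZMod q) ^ 2 * k = j} ⊆
        {d ∈ range (D + 1) | ((d : ℕ) : ZMod n) ^ 2 = (((ZMod.unitOfCoprime w hwco) ^ 2 :
          (ZMod n)ˣ) : ZMod n)} := by
      intro d hd
      have hd1 := mem_filter.1 hd
      have hd2 := mem_Icc.1 (mem_filter.1 hd1.1).1
      rw [mem_filter, mem_range, Units.val_pow_eq_pow_val, ZMod.coe_unitOfCoprime]
      refine ⟨by omega, ?_⟩
      have h1 : (q : ℤ) ∣ ((d : ℤ) ^ 2 - (w : ℤ) ^ 2) * k.val := by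
        rw [← ZMod.intCast_zmod_eq_zero_iff_dvd]
        push_cast
        rw [hkv, sub_mul, hd1.2, (mem_filter.1 hw).2, sub_self]
      rw [hk', ← hgn] at h1
      push_cast at h1
      rw [mul_comm (k' : ℤ), mul_left_comm, mul_dvd_mul_iff_left (by exact_mod_cast hg.ne')] at h1
      have h2 : (n : ℤ) ∣ (d : ℤ) ^ 2 - (w : ℤ) ^ 2 :=
        (Nat.isCoprime_iff_coprime.2 hco.symm).dvd_of_dvd_mul_right h1
      rw [← ZMod.intCast_zmod_eq_zero_iff_dvd] at h2
      push_cast at h2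
      exact sub_eq_zero.1 h2
    have h5 : n * #{d ∈ s | ((d : ℕ) : ZMod q) ^ 2 * k = j} ≤ 5 * D * #q.divisors := by
      calc _ ≤ #n.divisors * (2 * (D + 1) + n) :=
            (Nat.mul_le_mul_left n (card_le_card hsub)).trans (card_filter_sq_eq_le hn0 _ _)
        _ ≤ #q.divisors * (5 * D) := by
            refine Nat.mul_le_mul (card_le_card (Nat.divisors_subset_of_dvd hq.ne' hnq)) ?_
            have := Nat.le_of_dvd hq hnq
            omega
        _ = _ := mul_comm _ _
    rw [mul_comm]
    exact_mod_cast h5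
  rw [← sum_fiberwise_of_maps_to hmaps]
  calc _ ≤ ∑ j : ZMod q with j ≠ 0 ∧ g ∣ j.valMinAbs.natAbs,
          5 * D * #q.divisors / n * ((q : ℝ) / (2 * j.valMinAbs.natAbs)) := by
        refine sum_le_sum fun j _ => ?_
        rw [sum_congr rfl fun d hd => by rw [(mem_filter.1 hd).2], sum_const, nsmul_eq_mul]
        exact mul_le_mul_of_nonneg_right (hfib j) (by positivity)
    _ ≤ 5 * D * #q.divisors / n * (n * (harmonic n : ℝ)) := by
        rw [← mul_sum]
        gcongr
        exact sum_inv_natAbs_valMinAbs_le hgn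
    _ = 5 * D * #q.divisors * (harmonic n : ℝ) := by
        have : (n : ℝ) ≠ 0 := by exact_mod_cast (by omega : n ≠ 0)
        field_simp
    _ ≤ _ := by
        gcongr
        simp only [harmonic]
        exact sum_le_sum_of_subset_of_nonneg (range_subset_range.2 (Nat.le_of_dvd hq hnq))
          fun _ _ _ => by positivity

/-! ### Second moment of the small square divisors. -/

/-- The contribution of the square divisors `d² ≤ D²` to the error term. -/
noncomputable def mainError (x : ℝ) (q D : ℕ) (a : ZMod q) : ℝ :=
  ∑ d ∈ Icc 1 D with d.Coprime q,
    (ArithmeticFunction.moebius d : ℝ) * (sqMulCount x q d a - x / ((d : ℝ) ^ 2 * q))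

theorem abs_floor_div_sub_le {x : ℝ} (hx : 0 ≤ x) {d : ℕ} (hd : 1 ≤ d) :
    |((⌊x⌋₊ / d ^ 2 : ℕ) : ℝ) - x / (d : ℝ) ^ 2| ≤ 1 := by
  have e : ⌊x⌋₊ / d ^ 2 = ⌊x / (d : ℝ) ^ 2⌋₊ := by
    rw [← Nat.floor_div_natCast, Nat.cast_pow]
  have h0 : 0 ≤ x / (d : ℝ) ^ 2 := by positivity
  rw [e, abs_le]
  constructor <;> linarith [Nat.floor_le h0, Nat.lt_floor_add_one (x / (d : ℝ) ^ 2)]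

theorem sum_sqMulCount_mul (x : ℝ) {q : ℕ} [NeZero q] (d : ℕ) (F : ZMod q → ℂ) :
    ∑ a : ZMod q, (sqMulCount x q d a : ℂ) * F a
      = ∑ m ∈ Icc 1 (⌊x⌋₊ / d ^ 2), F ((m * d ^ 2 : ℕ) : ZMod q) := by
  rw [← sum_fiberwise (Icc 1 (⌊x⌋₊ / d ^ 2)) fun m => ((m * d ^ 2 : ℕ) : ZMod q)]
  refine sum_congr rfl fun a _ => ?_
  rw [sum_congr rfl fun m hm => by rw [(mem_filter.1 hm).2], sum_const, nsmul_eq_mul, sqMulCount]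

/-- At k = 0 each d leaves only a rounding error of at most 1. At k ≠ 0 the expected value is
orthogonal to the character, leaving geometric sums. -/
theorem norm_fourier_mainError_le {x : ℝ} (hx : 0 ≤ x) {q D : ℕ} [NeZero q] (hD : q ≤ D)
    (k : ZMod q) : ‖∑ a : ZMod q, (mainError x q D a : ℂ) * ZMod.stdAddChar (a * k)‖
      ≤ 5 * D * #q.divisors * (harmonic q : ℝ) := by
  have hq : 0 < q := NeZero.pos q
  have hqR : (q : ℂ) ≠ 0 := by exact_mod_cast hq.ne'
  have hexp : ∑ a : ZMod q, (mainError x q D a : ℂ) * ZMod.stdAddChar (a * k)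
      = ∑ d ∈ Icc 1 D with d.Coprime q, (ArithmeticFunction.moebius d : ℂ) *
        (∑ m ∈ Icc 1 (⌊x⌋₊ / d ^ 2), ZMod.stdAddChar (((m * d ^ 2 : ℕ) : ZMod q) * k)
          - x / ((d : ℂ) ^ 2 * q) * ∑ a : ZMod q, ZMod.stdAddChar (a * k)) := by
    simp only [mainError, Complex.ofReal_sum, sum_mul]
    rw [sum_comm]
    refine sum_congr rfl fun d _ => ?_
    rw [← sum_sqMulCount_mul x d fun a => ZMod.stdAddChar (a * k), mul_sum, ← sum_sub_distrib,
      mul_sum]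
    refine sum_congr rfl fun a _ => ?_
    push_cast
    ring
  have hmu : ∀ d, ‖(ArithmeticFunction.moebius d : ℂ)‖ ≤ 1 := by
    intro d
    rw [Complex.norm_intCast]
    exact_mod_cast ArithmeticFunction.abs_moebius_le_one
  rw [hexp]
  refine (norm_sum_le _ _).trans ?_
  simp only [AddChar.sum_mulShift _ (ZMod.isPrimitive_stdAddChar q), norm_mul]
  by_cases hk : k = 0
  · have h1 : ∀ d ∈ Icc 1 D, ‖(ArithmeticFunction.moebius d : ℂ)‖ *
        ‖∑ m ∈ Icc 1 (⌊x⌋₊ / d ^ 2), ZMod.stdAddChar (((m * d ^ 2 : ℕ) : ZMod q) * k)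
          - x / ((d : ℂ) ^ 2 * q) * ((if k = 0 then Fintype.card (ZMod q) else 0 : ℕ) : ℂ)‖
          ≤ 1 := by
      intro d hd
      have hd1 := (mem_Icc.1 hd).1
      refine mul_le_one₀ (hmu d) (norm_nonneg _) ?_
      have e : ∑ m ∈ Icc 1 (⌊x⌋₊ / d ^ 2), ZMod.stdAddChar (((m * d ^ 2 : ℕ) : ZMod q) * k)
          - x / ((d : ℂ) ^ 2 * q) * ((if k = 0 then Fintype.card (ZMod q) else 0 : ℕ) : ℂ)
          = ((((⌊x⌋₊ / d ^ 2 : ℕ) : ℝ) - x / (d : ℝ) ^ 2 : ℝ) : ℂ) := by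
        simp only [hk, mul_zero, AddChar.map_zero_eq_one, sum_const, Nat.card_Icc,
          add_tsub_cancel_right, nsmul_eq_mul, mul_one, if_true, ZMod.card]
        have : (d : ℂ) ≠ 0 := by exact_mod_cast (by omega : d ≠ 0)
        push_cast
        field_simp
      rw [e, Complex.norm_real]
      exact abs_floor_div_sub_le hx hd1
    calc _ ≤ ∑ d ∈ Icc 1 D with d.Coprime q, (1 : ℝ) :=
          sum_le_sum fun d hd => h1 d (mem_filter.1 hd).1
      _ ≤ ∑ d ∈ Icc 1 D, (1 : ℝ) :=
          sum_le_sum_of_subset_of_nonneg (filter_subset _ _) fun _ _ _ => zero_le_one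
      _ = D := by simp
      _ = 1 * D * 1 * 1 := by ring
      _ ≤ _ := by
          have h2 : (1 : ℝ) ≤ #q.divisors := by
            exact_mod_cast card_pos.2 ⟨1, Nat.one_mem_divisors.2 hq.ne'⟩
          have h3 : (1 : ℝ) ≤ (harmonic q : ℝ) := by
            have : (1 : ℚ) ≤ harmonic q := by
              calc (1 : ℚ) = harmonic 1 := by simp [harmonic]
                _ ≤ harmonic q := sum_le_sum_of_subset_of_nonneg (range_subset_range.2 hq)
                    fun _ _ _ => by positivity
            exact_mod_cast this
          gcongr
          norm_num
  · refine le_trans (sum_le_sum fun d hd => ?_) (sum_coprime_sq_mul_le hD hk)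
    have hu : IsUnit ((d : ZMod q) ^ 2) :=
      ((ZMod.isUnit_iff_coprime d q).2 (mem_filter.1 hd).2).pow 2
    have hne : (d : ZMod q) ^ 2 * k ≠ 0 := fun h => hk (hu.mul_right_eq_zero.1 h)
    rw [if_neg hk, Nat.cast_zero, mul_zero, sub_zero]
    refine (mul_le_of_le_one_left (norm_nonneg _) (hmu d)).trans ?_
    refine le_trans (le_of_eq ?_) (norm_sum_stdAddChar_le hne (⌊x⌋₊ / d ^ 2))
    congr 1
    refine sum_congr rfl fun m _ => ?_
    push_cast
    rw [mul_assoc]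

theorem sum_mainError_sq_le {x : ℝ} (hx : 0 ≤ x) {q D : ℕ} [NeZero q] (hD : q ≤ D) :
    ∑ a : ZMod q, mainError x q D a ^ 2 ≤ (5 * D * #q.divisors * (harmonic q : ℝ)) ^ 2 := by
  have hq : (0 : ℝ) < q := by exact_mod_cast NeZero.pos q
  refine le_of_mul_le_mul_left ?_ hq
  rw [← sum_norm_sq_fourier]
  calc _ ≤ ∑ _k : ZMod q, (5 * D * #q.divisors * (harmonic q : ℝ)) ^ 2 :=
        sum_le_sum fun k _ => pow_le_pow_left₀ (norm_nonneg _) (norm_fourier_mainError_le hx hD k) 2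
    _ = _ := by rw [sum_const, card_univ, ZMod.card, nsmul_eq_mul]

/-! ### Pointwise bound for the large square divisors. -/

theorem sum_inv_sqrt_le (M : ℕ) : ∑ m ∈ Icc 1 M, (√(m : ℝ))⁻¹ ≤ 2 * √(M : ℝ) := by
  induction M with
  | zero => simp
  | succ M ih =>
    rw [sum_Icc_succ_top (by omega)]
    have hs : 0 < √((M + 1 : ℕ) : ℝ) := Real.sqrt_pos.2 (by positivity)
    have h1 : √((M + 1 : ℕ) : ℝ) ^ 2 = M + 1 := by
      rw [Real.sq_sqrt (by positivity)]; push_cast; rfl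
    have h2 : √(M : ℝ) ^ 2 = M := Real.sq_sqrt (by positivity)
    have h3 : (√((M + 1 : ℕ) : ℝ))⁻¹ ≤ 2 * √((M + 1 : ℕ) : ℝ) - 2 * √(M : ℝ) := by
      rw [inv_le_iff_one_le_mul₀ hs]
      nlinarith [sq_nonneg (√((M + 1 : ℕ) : ℝ) - √(M : ℝ))]
    linarith

theorem card_filter_mul_sq_eq_le {x : ℝ} (hx : 0 ≤ x) {q : ℕ} (hq : 1 ≤ q) (a : (ZMod q)ˣ)
    {m : ℕ} (hm : 1 ≤ m) (s : Finset ℕ) :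
    (q : ℝ) * #{d ∈ s | m * d ^ 2 ≤ ⌊x⌋₊ ∧ ((m * d ^ 2 : ℕ) : ZMod q) = a}
      ≤ #q.divisors * (2 * (√x * (√(m : ℝ))⁻¹) + 3 * q) := by
  have hqR : (1 : ℝ) ≤ q := by exact_mod_cast hq
  rcases ({d ∈ s | m * d ^ 2 ≤ ⌊x⌋₊ ∧ ((m * d ^ 2 : ℕ) : ZMod q) = a}).eq_empty_or_nonempty
    with h0 | ⟨w, hw⟩
  · rw [h0, card_empty, Nat.cast_zero, mul_zero]
    positivity
  have hmco : m.Coprime q := by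
    have hu : IsUnit (((m * w ^ 2 : ℕ) : ZMod q)) := (mem_filter.1 hw).2.2 ▸ a.isUnit
    rw [ZMod.isUnit_iff_coprime] at hu
    exact Nat.Coprime.coprime_dvd_left (Dvd.intro _ rfl) hu
  set u := ZMod.unitOfCoprime m hmco
  have hsub : {d ∈ s | m * d ^ 2 ≤ ⌊x⌋₊ ∧ ((m * d ^ 2 : ℕ) : ZMod q) = a} ⊆
      {d ∈ range (Nat.sqrt (⌊x⌋₊ / m) + 1) | ((d : ℕ) : ZMod q) ^ 2
        = ((u⁻¹ * a : (ZMod q)ˣ) : ZMod q)} := by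
    intro d hd
    obtain ⟨-, hd1, hd2⟩ := mem_filter.1 hd
    rw [mem_filter, mem_range, Nat.lt_succ_iff, Nat.le_sqrt', Nat.le_div_iff_mul_le hm]
    refine ⟨by rwa [mul_comm], ?_⟩
    rw [Units.val_mul, ← hd2]
    push_cast
    rw [← ZMod.coe_unitOfCoprime m hmco, Units.inv_mul_cancel_left]
  have h1 : q * #{d ∈ s | m * d ^ 2 ≤ ⌊x⌋₊ ∧ ((m * d ^ 2 : ℕ) : ZMod q) = a}
      ≤ #q.divisors * (2 * (Nat.sqrt (⌊x⌋₊ / m) + 1) + q) :=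
    (Nat.mul_le_mul_left q (card_le_card hsub)).trans (card_filter_sq_eq_le hq _ _)
  have h2 : (Nat.sqrt (⌊x⌋₊ / m) : ℝ) ≤ √x * (√(m : ℝ))⁻¹ := by
    rw [← div_eq_mul_inv, ← Real.sqrt_div hx]
    refine Real.le_sqrt_of_sq_le ?_
    calc (Nat.sqrt (⌊x⌋₊ / m) : ℝ) ^ 2 ≤ (⌊x⌋₊ / m : ℕ) := by
          exact_mod_cast Nat.sqrt_le' _
      _ ≤ (⌊x⌋₊ : ℝ) / m := Nat.cast_div_le
      _ ≤ x / m := by gcongr; exact Nat.floor_le hx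
  calc (q : ℝ) * #{d ∈ s | m * d ^ 2 ≤ ⌊x⌋₊ ∧ ((m * d ^ 2 : ℕ) : ZMod q) = a}
      ≤ #q.divisors * (2 * (Nat.sqrt (⌊x⌋₊ / m) + 1) + q) := by exact_mod_cast h1
    _ ≤ _ := by
        refine mul_le_mul_of_nonneg_left ?_ (by positivity)
        linarith

theorem sum_sqMulCount_tail_le {x : ℝ} (hx : 0 ≤ x) {q : ℕ} (hq : 1 ≤ q) (a : (ZMod q)ˣ)
    {D : ℕ} (hD : 1 ≤ D) (N : ℕ) :
    ∑ d ∈ Ioc D N, (sqMulCount x q d a : ℝ)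
      ≤ #q.divisors * (4 * (x / (q * D)) + 3 * (x / (D : ℝ) ^ 2)) := by
  have hqR : (0 : ℝ) < q := by exact_mod_cast hq
  have hDR : (0 : ℝ) < D := by exact_mod_cast hD
  set M := ⌊x⌋₊ / D ^ 2
  have hM : (M : ℝ) ≤ x / (D : ℝ) ^ 2 := by
    calc (M : ℝ) ≤ (⌊x⌋₊ : ℝ) / (D ^ 2 : ℕ) := Nat.cast_div_le
      _ ≤ x / (D : ℝ) ^ 2 := by
        push_cast
        gcongr
        exact Nat.floor_le hx
  -- Summing over d first is the gain: d > D forces m ≤ x/D², and for each m the d are square roots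
  -- of a/m modulo q.
  have hswap : ∑ d ∈ Ioc D N, (sqMulCount x q d a : ℝ)
      ≤ ∑ m ∈ Icc 1 M,
        (#{d ∈ Ioc D N | m * d ^ 2 ≤ ⌊x⌋₊ ∧ ((m * d ^ 2 : ℕ) : ZMod q) = a} : ℝ) := by
    have e : ∑ d ∈ Ioc D N, sqMulCount x q d a
        ≤ ∑ d ∈ Ioc D N, #{m ∈ Icc 1 M | m * d ^ 2 ≤ ⌊x⌋₊ ∧
          ((m * d ^ 2 : ℕ) : ZMod q) = a} := by
      refine sum_le_sum fun d hd => card_le_card fun m hm => ?_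
      have hd1 := mem_Ioc.1 hd
      obtain ⟨hm1, hm2⟩ := mem_filter.1 hm
      rw [mem_Icc, Nat.le_div_iff_mul_le (pow_pos (by omega) 2)] at hm1
      rw [mem_filter, mem_Icc, Nat.le_div_iff_mul_le (by positivity)]
      refine ⟨⟨hm1.1, le_trans ?_ hm1.2⟩, hm1.2, hm2⟩
      exact Nat.mul_le_mul_left m (Nat.pow_le_pow_left hd1.1.le 2)
    simp only [card_filter] at e ⊢
    rw [sum_comm] at e
    exact_mod_cast e
  refine hswap.trans (le_of_mul_le_mul_left ?_ hqR)
  rw [mul_sum]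
  calc _ ≤ ∑ m ∈ Icc 1 M, (#q.divisors * (2 * (√x * (√(m : ℝ))⁻¹) + 3 * q) : ℝ) :=
        sum_le_sum fun m hm => card_filter_mul_sq_eq_le hx hq a (mem_Icc.1 hm).1 _
    _ = #q.divisors * (2 * √x * (∑ m ∈ Icc 1 M, (√(m : ℝ))⁻¹) + 3 * q * M) := by
        rw [← mul_sum, sum_add_distrib, mul_sum, sum_const, Nat.card_Icc, nsmul_eq_mul]
        simp only [add_tsub_cancel_right, mul_assoc]
        ring
    _ ≤ #q.divisors * (2 * √x * (2 * √(x / (D : ℝ) ^ 2)) + 3 * q * (x / (D : ℝ) ^ 2)) := by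
        gcongr
        exact (sum_inv_sqrt_le M).trans (by gcongr)
    _ = _ := by
        rw [Real.sqrt_div hx, Real.sqrt_sq hDR.le]
        field_simp
        rw [Real.sq_sqrt hx]
        ring

/-! ### Chebyshev's inequality and the choice of parameters. -/

theorem abs_E_sub_mainError_le {x : ℝ} (hx : 0 ≤ x) {q : ℕ} (hq : 1 ≤ q) (a : (ZMod q)ˣ)
    {D : ℕ} (hD : 1 ≤ D) :
    |E x q a - mainError x q D a|
      ≤ #q.divisors * (4 * (x / (q * D)) + 3 * (x / (D : ℝ) ^ 2)) + x / (q * D) := by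
  have hqR : (0 : ℝ) < q := by exact_mod_cast hq
  set N := ⌊x⌋₊ + D
  have hS := S_eq_sum_moebius x q a (N := N) (by omega)
  have hsplit : ∑ d ∈ Icc 1 N, (ArithmeticFunction.moebius d : ℝ) * sqMulCount x q d a
      = ∑ d ∈ Icc 1 D, (ArithmeticFunction.moebius d : ℝ) * sqMulCount x q d a
        + ∑ d ∈ Ioc D N, (ArithmeticFunction.moebius d : ℝ) * sqMulCount x q d a := by
    rw [← sum_union]
    · refine sum_congr ?_ fun _ _ => rfl
      ext d
      simp only [mem_union, mem_Icc, mem_Ioc]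
      omega
    · rw [disjoint_left]
      intro d h1 h2
      have := (mem_Icc.1 h1).2
      have := (mem_Ioc.1 h2).1
      omega
  have hmain : mainError x q D a
      = ∑ d ∈ Icc 1 D, (ArithmeticFunction.moebius d : ℝ) * sqMulCount x q d a
        - x / q * ∑ d ∈ Icc 1 D, cTerm q d := by
    rw [mainError, sum_filter, mul_sum, ← sum_sub_distrib]
    refine sum_congr rfl fun d _ => ?_
    by_cases hd : d.Coprime q
    · rw [if_pos hd, cTerm, if_pos hd]
      field_simp
    · rw [if_neg hd, cTerm, if_neg hd, sqMulCount_eq_zero_of_not_coprime x a hd]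
      simp
  have hE : E x q a - mainError x q D a
      = ∑ d ∈ Ioc D N, (ArithmeticFunction.moebius d : ℝ) * sqMulCount x q d a
        - x / q * (c q - ∑ d ∈ Icc 1 D, cTerm q d) := by
    rw [E, hS, hsplit, hmain]
    ring
  rw [hE]
  refine (abs_sub _ _).trans (add_le_add ?_ ?_)
  · refine (abs_sum_le_sum_abs _ _).trans (le_trans (sum_le_sum fun d _ => ?_)
      (sum_sqMulCount_tail_le hx hq a hD N))
    rw [abs_mul, Nat.abs_cast]
    refine mul_le_of_le_one_left (by positivity) ?_
    exact_mod_cast ArithmeticFunction.abs_moebius_le_one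
  · rw [abs_mul, abs_of_nonneg (by positivity)]
    calc x / q * |c q - ∑ d ∈ Icc 1 D, cTerm q d| ≤ x / q * (D : ℝ)⁻¹ := by
          gcongr
          exact abs_c_sub_sum_le q hD
      _ = x / (q * D) := by rw [← div_eq_mul_inv, div_div]

/-- With `x = X⁴` and `q = Q⁴`, the proportion of classes whose error term exceeds `W X Q`. -/
theorem proportion_large_error_le {x X Q W : ℝ} {q : ℕ} (hq : 1 ≤ q) (hx : x = X ^ 4)
    (hqQ : (q : ℝ) = Q ^ 4) (hQ : 1 ≤ Q) (hQX : Q ^ 3 ≤ X) (hXQ : X ≤ Q ^ 4)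
    (hW : 16 * (#q.divisors : ℝ) ≤ W) :
    1 / (Nat.totient q : ℝ) * (Set.ncard {a : (ZMod q)ˣ | |E x q a| > W * X * Q} : ℝ)
      ≤ 400 * (#q.divisors : ℝ) ^ 3 * (harmonic q : ℝ) ^ 2 / W * (X ^ 2 / W / (q : ℝ) ^ 2) := by
  have : NeZero q := ⟨by omega⟩
  have hQ0 : 0 < Q := by linarith
  have hQX1 : Q ≤ X := (le_self_pow₀ hQ (by norm_num)).trans hQX
  have hX0 : 0 < X := by linarith
  have hdpos : (1 : ℝ) ≤ #q.divisors := by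
    exact_mod_cast card_pos.2 ⟨1, Nat.one_mem_divisors.2 (by omega)⟩
  have hW0 : 0 < W := by linarith
  have hx0 : 0 ≤ x := by rw [hx]; positivity
  have hqR : (0 : ℝ) < q := by exact_mod_cast hq
  set D0 : ℝ := X ^ 2 / Q
  have hD0 : Q ^ 4 ≤ D0 := by
    rw [le_div_iff₀ hQ0]
    calc Q ^ 4 * Q ≤ Q ^ 4 * Q * Q := le_mul_of_one_le_right (by positivity) hQ
      _ = (Q ^ 3) ^ 2 := by ring
      _ ≤ X ^ 2 := by gcongr
  have hD01 : 1 ≤ D0 := (one_le_pow₀ hQ).trans hD0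
  set D := ⌈D0⌉₊
  have hDle : D0 ≤ D := Nat.le_ceil _
  have hDub : (D : ℝ) ≤ 2 * D0 := by linarith [Nat.ceil_lt_add_one (by linarith : 0 ≤ D0)]
  have hDpos : (0 : ℝ) < D := by linarith
  have hqD : q ≤ D := by
    have : (q : ℝ) ≤ D := by rw [hqQ]; linarith
    exact_mod_cast this
  have h1 : x / (q * D) ≤ X * Q := by
    calc x / (q * D) ≤ x / (q * D0) := by gcongr
      _ = X * X / Q ^ 3 := by
        rw [hx, hqQ]
        simp only [D0]
        field_simp
      _ ≤ X * Q ^ 4 / Q ^ 3 := by gcongr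
      _ = X * Q := by field_simp
  have h2 : x / (D : ℝ) ^ 2 ≤ X * Q := by
    calc x / (D : ℝ) ^ 2 ≤ x / D0 ^ 2 := by gcongr
      _ = Q * Q := by
        rw [hx]
        simp only [D0]
        field_simp
      _ ≤ X * Q := by gcongr
  -- The constants 4 + 3 + 1 = 8 are half of the 16 in `hW`, so the tail uses at most half the
  -- threshold.
  have hdiff : ∀ a : (ZMod q)ˣ, |E x q a - mainError x q D a| ≤ W / 2 * (X * Q) := by
    intro a
    calc _ ≤ _ := abs_E_sub_mainError_le hx0 hq a (by omega)
      _ ≤ #q.divisors * (4 * (X * Q) + 3 * (X * Q)) + #q.divisors * (X * Q) := by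
        gcongr
        exact h1.trans (le_mul_of_one_le_left (by positivity) hdpos)
      _ = (16 * #q.divisors) / 2 * (X * Q) := by ring
      _ ≤ _ := by gcongr
  set B : Finset (ZMod q)ˣ := {a | |E x q a| > W * X * Q}
  have hB : Set.ncard {a : (ZMod q)ˣ | |E x q a| > W * X * Q} = #B := by
    rw [← Set.ncard_coe_finset]
    congr 1
    ext a
    simp [B]
  have hcheb : (#B : ℝ) * (W / 2 * (X * Q)) ^ 2
      ≤ (5 * (2 * D0) * #q.divisors * (harmonic q : ℝ)) ^ 2 := by
    have hH : (0 : ℝ) ≤ (harmonic q : ℝ) := by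
      have : (0 : ℚ) ≤ harmonic q := sum_nonneg fun _ _ => by positivity
      exact_mod_cast this
    calc (#B : ℝ) * (W / 2 * (X * Q)) ^ 2 = ∑ _a ∈ B, (W / 2 * (X * Q)) ^ 2 := by
          rw [sum_const, nsmul_eq_mul]
      _ ≤ ∑ a ∈ B, mainError x q D (a : ZMod q) ^ 2 := by
          refine sum_le_sum fun a ha => ?_
          have ha1 : |E x q a| > W * X * Q := (mem_filter.1 ha).2
          have h3 := abs_sub_abs_le_abs_sub (E x q a) (mainError x q D a)
          rw [← sq_abs (mainError x q D a)]
          refine pow_le_pow_left₀ (by positivity) ?_ 2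
          linarith [hdiff a]
      -- Enlarging to all units, then to all residues, only adds squares and makes Parseval
      -- available.
      _ ≤ ∑ a : (ZMod q)ˣ, mainError x q D (a : ZMod q) ^ 2 :=
          sum_le_sum_of_subset_of_nonneg (subset_univ _) fun _ _ _ => sq_nonneg _
      _ = ∑ a ∈ univ.map ⟨((↑) : (ZMod q)ˣ → ZMod q), Units.val_injective⟩,
            mainError x q D a ^ 2 := by rw [sum_map]; rfl
      _ ≤ ∑ a : ZMod q, mainError x q D a ^ 2 :=
          sum_le_sum_of_subset_of_nonneg (subset_univ _) fun _ _ _ => sq_nonneg _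
      _ ≤ (5 * D * #q.divisors * (harmonic q : ℝ)) ^ 2 := sum_mainError_sq_le hx0 hqD
      _ ≤ _ := by gcongr
  have hcard : (#B : ℝ) ≤ 400 * X ^ 2 * (#q.divisors : ℝ) ^ 2 * (harmonic q : ℝ) ^ 2
      / (Q ^ 4 * W ^ 2) := by
    rw [← le_div_iff₀ (by positivity)] at hcheb
    refine hcheb.trans (le_of_eq ?_)
    simp only [D0]
    field_simp
    ring
  have hphi : 1 / (Nat.totient q : ℝ) ≤ #q.divisors / q := by
    have hp : (0 : ℝ) < Nat.totient q := by exact_mod_cast Nat.totient_pos.2 hq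
    rw [div_le_div_iff₀ hp hqR, one_mul, mul_comm]
    exact_mod_cast le_totient_mul_card_divisors q
  rw [hB]
  calc _ ≤ (#q.divisors : ℝ) / q * (400 * X ^ 2 * (#q.divisors : ℝ) ^ 2 * (harmonic q : ℝ) ^ 2
      / (Q ^ 4 * W ^ 2)) := by gcongr
    _ = _ := by
      rw [hqQ]
      field_simp

theorem proportion_le_one (q : ℕ) [NeZero q] (s : Set (ZMod q)ˣ) :
    1 / (Nat.totient q : ℝ) * (s.ncard : ℝ) ≤ 1 := by
  have hp : (0 : ℝ) < Nat.totient q := by exact_mod_cast Nat.totient_pos.2 (NeZero.pos q)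
  rw [one_div, inv_mul_le_iff₀ hp, mul_one]
  have := Set.ncard_le_ncard (Set.subset_univ s)
  rw [Set.ncard_univ, Nat.card_eq_fintype_card, ZMod.card_units_eq_totient] at this
  exact_mod_cast this

theorem exists_divisors_harmonic_le {ε : ℝ} (hε : 0 < ε) :
    ∃ C : ℝ, 1 ≤ C ∧ ∀ n : ℕ, 1 ≤ n → (#n.divisors : ℝ) ≤ C * (n : ℝ) ^ (ε / 2) ∧
      (#n.divisors : ℝ) ^ 3 * (harmonic n : ℝ) ^ 2 ≤ C * (n : ℝ) ^ ε := by
  -- The product τ³H² has five factors, each O(n^{ε/5}).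
  have hη : 0 < ε / 5 := by positivity
  obtain ⟨K, hK, hd⟩ := exists_card_divisors_le hη
  set L := 1 + 1 / (ε / 5)
  have hL : 1 ≤ L := le_add_of_nonneg_right (by positivity)
  refine ⟨K ^ 3 * L ^ 2, one_le_mul_of_one_le_of_one_le (one_le_pow₀ hK) (one_le_pow₀ hL),
    fun n hn => ?_⟩
  have hnR : (1 : ℝ) ≤ n := by exact_mod_cast hn
  have hp1 : 1 ≤ (n : ℝ) ^ (ε / 5) := Real.one_le_rpow hnR hη.le
  have hH : (harmonic n : ℝ) ≤ L * (n : ℝ) ^ (ε / 5) := by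
    calc (harmonic n : ℝ) ≤ 1 + Real.log n := harmonic_le_one_add_log n
      _ ≤ (n : ℝ) ^ (ε / 5) + (n : ℝ) ^ (ε / 5) / (ε / 5) :=
        add_le_add hp1 (Real.log_le_rpow_div (by positivity) hη)
      _ = _ := by simp only [L]; ring
  have hH0 : (0 : ℝ) ≤ (harmonic n : ℝ) := by
    have : (0 : ℚ) ≤ harmonic n := sum_nonneg fun _ _ => by positivity
    exact_mod_cast this
  constructor
  · calc (#n.divisors : ℝ) ≤ K * (n : ℝ) ^ (ε / 5) := hd n hn
      _ ≤ K ^ 3 * L ^ 2 * (n : ℝ) ^ (ε / 2) := by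
        gcongr
        · calc K ≤ K ^ 3 := le_self_pow₀ hK (by norm_num)
            _ ≤ K ^ 3 * L ^ 2 := le_mul_of_one_le_right (by positivity) (one_le_pow₀ hL)
        · norm_num
  · calc (#n.divisors : ℝ) ^ 3 * (harmonic n : ℝ) ^ 2
        ≤ (K * (n : ℝ) ^ (ε / 5)) ^ 3 * (L * (n : ℝ) ^ (ε / 5)) ^ 2 := by
          gcongr
          exact hd n hn
      _ = K ^ 3 * L ^ 2 * ((n : ℝ) ^ (ε / 5)) ^ 5 := by ring
      _ = _ := by
          rw [← Real.rpow_natCast ((n : ℝ) ^ (ε / 5)), ← Real.rpow_mul (by positivity)]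
          congr 2
          push_cast
          ring

theorem exists_proportion_bound {ε : ℝ} (hε : 0 < ε) :
    ∃ C : ℝ, 0 < C ∧ ∀ (x : ℝ) (q : ℕ), 1 ≤ x →
      x ^ (1 / 4 : ℝ) ≤ (q : ℝ) → (q : ℝ) ≤ x ^ (1 / 3 : ℝ) →
      1 / (Nat.totient q : ℝ) *
          (Set.ncard {a : (ZMod q)ˣ |
            |E x q a| > x ^ (1 / 4 + ε : ℝ) * (q : ℝ) ^ (1 / 4 : ℝ)} : ℝ)
        ≤ C * (x ^ (1 / 2 - ε : ℝ) / (q : ℝ) ^ 2) := by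
  obtain ⟨K, hK, hdiv⟩ := exists_divisors_harmonic_le hε
  -- From x0 on, 16τ(q) ≤ 16K q^{ε/2} ≤ x^ε. Below x0 the proportion is bounded by 1, and q² ≤
  -- x^{2/3} = x^{1/6+ε} x^{1/2−ε} accounts for the second term of the constant.
  set x0 : ℝ := (16 * K) ^ (ε / 2)⁻¹
  have hx0 : 1 ≤ x0 := Real.one_le_rpow (by linarith) (by positivity)
  refine ⟨400 * K + x0 ^ (1 / 6 + ε), by positivity, fun x q hx hq1 hq2 => ?_⟩
  have hxpos : 0 < x := by linarith
  have hqR1 : (1 : ℝ) ≤ q := (Real.one_le_rpow hx (by norm_num)).trans hq1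
  have hq : 1 ≤ q := by exact_mod_cast hqR1
  have : NeZero q := ⟨by omega⟩
  have hqx : (q : ℝ) ≤ x := hq2.trans (Real.rpow_le_self_of_one_le hx (by norm_num))
  rcases le_or_gt x0 x with hlarge | hsmall
  · have hxε : 16 * K ≤ x ^ (ε / 2) := by
      calc 16 * K = x0 ^ (ε / 2) := by
            rw [← Real.rpow_mul (by positivity), inv_mul_cancel₀ (by positivity), Real.rpow_one]
        _ ≤ _ := by gcongr
    have hW : 16 * (#q.divisors : ℝ) ≤ x ^ ε := by
      calc 16 * (#q.divisors : ℝ) ≤ 16 * (K * (q : ℝ) ^ (ε / 2)) := by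
            gcongr
            exact (hdiv q hq).1
        _ = 16 * K * (q : ℝ) ^ (ε / 2) := by ring
        _ ≤ x ^ (ε / 2) * x ^ (ε / 2) := by gcongr
        _ = x ^ ε := by rw [← Real.rpow_add hxpos, add_halves]
    have hX4 : x = (x ^ (1 / 4 : ℝ)) ^ 4 := by
      rw [← Real.rpow_natCast, ← Real.rpow_mul hxpos.le]; norm_num
    have hQ4 : (q : ℝ) = ((q : ℝ) ^ (1 / 4 : ℝ)) ^ 4 := by
      rw [← Real.rpow_natCast, ← Real.rpow_mul (by positivity)]; norm_num
    have hQX : ((q : ℝ) ^ (1 / 4 : ℝ)) ^ 3 ≤ x ^ (1 / 4 : ℝ) := by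
      calc ((q : ℝ) ^ (1 / 4 : ℝ)) ^ 3 ≤ ((x ^ (1 / 3 : ℝ)) ^ (1 / 4 : ℝ)) ^ 3 := by gcongr
        _ = _ := by
          rw [← Real.rpow_natCast, ← Real.rpow_mul hxpos.le, ← Real.rpow_mul hxpos.le]
          norm_num
    have h := proportion_large_error_le hq hX4 hQ4 (Real.one_le_rpow hqR1 (by norm_num)) hQX
      (by rwa [← hQ4]) hW
    have e1 : x ^ (1 / 4 + ε : ℝ) = x ^ ε * x ^ (1 / 4 : ℝ) := by
      rw [Real.rpow_add hxpos, mul_comm]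
    have e2 : x ^ (1 / 2 - ε : ℝ) = (x ^ (1 / 4 : ℝ)) ^ 2 / x ^ ε := by
      rw [Real.rpow_sub hxpos, ← Real.rpow_natCast, ← Real.rpow_mul hxpos.le]
      norm_num
    rw [e1, e2]
    refine h.trans (mul_le_mul_of_nonneg_right ?_ (by positivity))
    rw [div_le_iff₀ (by positivity)]
    calc 400 * (#q.divisors : ℝ) ^ 3 * (harmonic q : ℝ) ^ 2
        = 400 * ((#q.divisors : ℝ) ^ 3 * (harmonic q : ℝ) ^ 2) := by ring
      _ ≤ 400 * (K * (q : ℝ) ^ ε) :=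
        mul_le_mul_of_nonneg_left (hdiv q hq).2 (by norm_num)
      _ ≤ 400 * (K * x ^ ε) := by gcongr
      _ = 400 * K * x ^ ε := by ring
      _ ≤ _ := by
        gcongr
        exact le_add_of_nonneg_right (by positivity)
  · refine (proportion_le_one q _).trans ?_
    have hq2' : (q : ℝ) ^ 2 ≤ x ^ (2 / 3 : ℝ) := by
      calc (q : ℝ) ^ 2 ≤ (x ^ (1 / 3 : ℝ)) ^ 2 := by gcongr
        _ = _ := by rw [← Real.rpow_natCast, ← Real.rpow_mul hxpos.le]; norm_num
    rw [← mul_div_assoc, one_le_div₀ (by positivity)]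
    calc (q : ℝ) ^ 2 ≤ x ^ (2 / 3 : ℝ) := hq2'
      _ = x ^ (1 / 6 + ε : ℝ) * x ^ (1 / 2 - ε : ℝ) := by
        rw [← Real.rpow_add hxpos]; congr 1; ring
      _ ≤ _ := by
        gcongr
        calc x ^ (1 / 6 + ε : ℝ) ≤ x0 ^ (1 / 6 + ε : ℝ) := by gcongr
          _ ≤ _ := le_add_of_nonneg_left (by positivity)

theorem proportion_compl (q : ℕ) [NeZero q] (s : Set (ZMod q)ˣ) :
    1 / (Nat.totient q : ℝ) * (s.ncard : ℝ) = 1 - 1 / (Nat.totient q : ℝ) * (sᶜ.ncard : ℝ) := by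
  have hp : (0 : ℝ) < Nat.totient q := by exact_mod_cast Nat.totient_pos.2 (NeZero.pos q)
  have h := Set.ncard_add_ncard_compl s
  rw [Nat.card_eq_fintype_card, ZMod.card_units_eq_totient] at h
  have h' : (s.ncard : ℝ) + sᶜ.ncard = q.totient := by exact_mod_cast h
  field_simp
  linarith

end SquarefreeAP

theorem corollary4 (ε : ℝ) (hε : 0 < ε) :
    (∃ C : ℝ, 0 < C ∧ ∀ (x : ℝ) (q : ℕ), 1 ≤ x →
      x ^ (1 / 4 : ℝ) ≤ (q : ℝ) → (q : ℝ) ≤ x ^ (1 / 3 : ℝ) →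
      1 / (Nat.totient q : ℝ) *
          (Set.ncard {a : (ZMod q)ˣ |
            |SquarefreeAP.E x q a| > x ^ (1 / 4 + ε : ℝ) * (q : ℝ) ^ (1 / 4 : ℝ)} : ℝ)
        ≤ C * (x ^ (1 / 2 - ε : ℝ) / (q : ℝ) ^ 2)) ∧
    (∀ δ : ℝ, 0 < δ → ∃ X : ℝ, 1 ≤ X ∧ ∀ (x : ℝ) (q : ℕ), X ≤ x →
      x ^ (1 / 4 : ℝ) ≤ (q : ℝ) → (q : ℝ) ≤ x ^ (1 / 3 : ℝ) →
      1 - δ ≤ 1 / (Nat.totient q : ℝ) *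
          (Set.ncard {a : (ZMod q)ˣ |
            |SquarefreeAP.E x q a| ≤ x ^ (1 / 4 + ε : ℝ) * (q : ℝ) ^ (1 / 4 : ℝ)} : ℝ)) := by
  obtain ⟨C, hC, hbound⟩ := SquarefreeAP.exists_proportion_bound hε
  -- Since q² ≥ x^{1/2}, the exceptional proportion is at most C x^{−ε}, which is at most δ once x ≥
  -- (C/δ)^{1/ε}.
  refine ⟨⟨C, hC, hbound⟩, fun δ hδ => ⟨max 1 ((C / δ) ^ ε⁻¹), le_max_left _ _,
    fun x q hx hq1 hq2 => ?_⟩⟩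
  have hx1 : 1 ≤ x := (le_max_left _ _).trans hx
  have hxpos : 0 < x := by linarith
  have hqR1 : (1 : ℝ) ≤ q := (Real.one_le_rpow hx1 (by norm_num)).trans hq1
  have : NeZero q := ⟨fun h => by simp [h] at hqR1; linarith⟩
  have hb := hbound x q hx1 hq1 hq2
  rw [SquarefreeAP.proportion_compl]
  have hcompl : {a : (ZMod q)ˣ |
      |SquarefreeAP.E x q a| ≤ x ^ (1 / 4 + ε : ℝ) * (q : ℝ) ^ (1 / 4 : ℝ)}ᶜ
      = {a : (ZMod q)ˣ |
        |SquarefreeAP.E x q a| > x ^ (1 / 4 + ε : ℝ) * (q : ℝ) ^ (1 / 4 : ℝ)} := by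
    ext a
    simp
  rw [hcompl]
  have hqsq : x ^ (1 / 2 : ℝ) ≤ (q : ℝ) ^ 2 := by
    calc x ^ (1 / 2 : ℝ) = (x ^ (1 / 4 : ℝ)) ^ 2 := by
          rw [← Real.rpow_natCast, ← Real.rpow_mul hxpos.le]; norm_num
      _ ≤ _ := by gcongr
  have hxε : C / δ ≤ x ^ ε := by
    calc C / δ = ((C / δ) ^ ε⁻¹) ^ ε := by
          rw [← Real.rpow_mul (by positivity), inv_mul_cancel₀ hε.ne', Real.rpow_one]
      _ ≤ x ^ ε := by
          gcongr
          exact (le_max_right _ _).trans hx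
  have hδ' : C * (x ^ (1 / 2 - ε : ℝ) / (q : ℝ) ^ 2) ≤ δ := by
    calc C * (x ^ (1 / 2 - ε : ℝ) / (q : ℝ) ^ 2)
        ≤ C * (x ^ (1 / 2 - ε : ℝ) / x ^ (1 / 2 : ℝ)) := by gcongr
      _ = C / x ^ ε := by
          rw [Real.rpow_sub hxpos]
          field_simp
      _ ≤ δ := by
          rw [div_le_iff₀ (by positivity)]
          rwa [div_le_iff₀' hδ] at hxε
  linarith
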